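/- Let $U\subseteq\mathbb R^n$ be open, let $f:U\to\mathbb R^n$ be smooth with Jacobian $A(x)=\frac{\partial f}{\partial x}(x)$, and let $K\subset U$ be compact, smoothly path-connected (any two points of $K$ are joined by a smooth path $[0,1]\to K$) and strictly forward invariant (every solution of $\dot x=f(x)$ with $x(0)\in K$ lies in the interior of $K$ for all $t>0$ in its interval of definition). Let $V:U\times\mathbb R^n\to[0,\infty)$ be a Finsler function, i.e. $V(x,\delta)$ is continuously differentiable where $\delta\neq0$, positive where $\delta\ne 0$, and, for each $x$, positively homogeneous of degree one and subadditive in $\delta$. Suppose that for some constant $\lambda>0$ $$\frac{\partial V}{\partial x}(x,\delta)\,f(x)+\frac{\partial V}{\partial \delta}(x,\delta)\,A(x)\,\delta\le-\lambda V(x,\delta)$$ for all $x\in K$ and all $\delta\ne0$ such that $\frac{\partial V}{\partial\delta}(x,\delta)f(x)=0$. Then for any two solutions $x_1,x_2:[0,\infty)\to U$ of $\dot x=f(x)$ with $x_1(0),x_2(0)\in K$ there is a time reparametrization $\tau$, i.e. a smooth, strictly increasing function $\tau:[0,\infty)\to[0,\infty)$ with $\tau(t)\to\infty$ as $t\to\infty$,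 such that $x_1(t)-x_2(\tau(t))\to0$ as $t\to\infty$. -/

import Mathlib

open Set Filter Topology
open scoped ContDiff

/-- `x` is, on the time interval `I`, a solution of `x' = f(x)` with values in the domain `U`
of the vector field `f` (one-sided derivatives at the end points of `I` that belong to `I`). -/
def IsSolutionOn {n : ℕ} (U : Set (EuclideanSpace ℝ (Fin n)))
    (f : EuclideanSpace ℝ (Fin n) → EuclideanSpace ℝ (Fin n))
    (I : Set ℝ) (x : ℝ → EuclideanSpace ℝ (Fin n)) : Prop :=
  ∀ t ∈ I, x t ∈ U ∧ HasDerivWithinAt x (f (x t)) I t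

/-- `K` is strictly forward invariant: every solution that starts in `K`, on whatever interval
`[0, T]` it is defined, is in the interior of `K` at all positive times. -/
def StrictlyForwardInvariant {n : ℕ} (U : Set (EuclideanSpace ℝ (Fin n)))
    (f : EuclideanSpace ℝ (Fin n) → EuclideanSpace ℝ (Fin n))
    (K : Set (EuclideanSpace ℝ (Fin n))) : Prop :=
  ∀ (T : ℝ) (x : ℝ → EuclideanSpace ℝ (Fin n)), 0 < T → IsSolutionOn U f (Icc 0 T) x →
    x 0 ∈ K → ∀ t ∈ Ioc 0 T, x t ∈ interior K

/-- Any two points of `K` are joined by a smooth path `[0, 1] → K`. -/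
def SmoothlyPathConnected {n : ℕ} (K : Set (EuclideanSpace ℝ (Fin n))) : Prop :=
  ∀ p ∈ K, ∀ q ∈ K, ∃ γ : ℝ → EuclideanSpace ℝ (Fin n),
    ContDiffOn ℝ ∞ γ (Icc 0 1) ∧ γ 0 = p ∧ γ 1 = q ∧ ∀ s ∈ Icc (0 : ℝ) 1, γ s ∈ K

/-- `V(x, δ)` is a Finsler function over the open set `U`: continuously differentiable off the
zero section, positive there, positively homogeneous of degree one and subadditive in `δ`.
Smoothness of higher order off the zero section, symmetry in `δ` and strong convexity, which are
sometimes required in addition, are not required here. -/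
structure IsFinslerFunction {n : ℕ} (U : Set (EuclideanSpace ℝ (Fin n)))
    (V : EuclideanSpace ℝ (Fin n) → EuclideanSpace ℝ (Fin n) → ℝ) : Prop where
  contDiffOn : ContDiffOn ℝ 1
    (fun p : EuclideanSpace ℝ (Fin n) × EuclideanSpace ℝ (Fin n) => V p.1 p.2) (U ×ˢ {0}ᶜ)
  pos : ∀ x ∈ U, ∀ δ, δ ≠ 0 → 0 < V x δ
  homogeneous : ∀ x ∈ U, ∀ (c : ℝ) (δ), 0 ≤ c → V x (c • δ) = c * V x δ
  subadditive : ∀ x ∈ U, ∀ δ₁ δ₂, V x (δ₁ + δ₂) ≤ V x δ₁ + V x δ₂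

/-- The transverse contraction condition with rate `lam` on `K`:
`∂V/∂x f(x) + ∂V/∂δ A(x) δ ≤ -lam V(x, δ)`, where `A` is the Jacobian of `f`, at all `x ∈ K` and
all `δ ≠ 0` with `∂V/∂δ f(x) = 0`. -/
def TransverselyContracting {n : ℕ}
    (f : EuclideanSpace ℝ (Fin n) → EuclideanSpace ℝ (Fin n))
    (K : Set (EuclideanSpace ℝ (Fin n)))
    (V : EuclideanSpace ℝ (Fin n) → EuclideanSpace ℝ (Fin n) → ℝ) (lam : ℝ) : Prop :=
  ∀ x ∈ K, ∀ δ, δ ≠ 0 → fderiv ℝ (fun w => V x w) δ (f x) = 0 →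
    fderiv ℝ (fun y => V y δ) x (f x) + fderiv ℝ (fun w => V x w) δ (fderiv ℝ f x δ)
      ≤ -lam * V x δ

/-- A time reparametrization: a smooth, increasing function `[0, ∞) → [0, ∞)` that tends to
infinity. -/
structure IsTimeReparametrization (τ : ℝ → ℝ) : Prop where
  contDiffOn : ContDiffOn ℝ ∞ τ (Ici 0)
  mapsTo : MapsTo τ (Ici 0) (Ici 0)
  strictMonoOn : StrictMonoOn τ (Ici 0)
  tendsto : Tendsto τ atTop atTop

/-! The hypothesis controls only those `δ` with `∂V/∂δ f = 0`. On the compact set of `(x, u)` with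
`x ∈ K`, `‖u‖ = 1`, a penalty argument removes this restriction: for a large gain `k`, the
linearised motion with the extra term `-k (∂V/∂δ f) f` decreases `V` at rate `lam / 2` in every
direction (`TransverselyContracting.exists_gain`). The extra term points along `f`, so it can be
realised by letting the second solution of a nearby pair run slightly faster or slower along its own
orbit.

This is discretised in `TransverselyContracting.exists_step`: while `x` runs for a fixed short time
`h`, `y` runs for a time `μ` close to `h`, and `V (x h) (y μ - x h)` is at most `q < 1` times its
initial value. The chord `y - x` replaces a Finsler distance, so no curves of minimal length are
needed. On iteration the chords decay geometrically. The corrections `μ - h` are bounded by a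
multiple of the chord, hence summable, and the accumulated time offset converges to some `σ`. Thus
solutions starting within a uniform distance `r` are asymptotic up to a constant shift.

Being asymptotic up to shift is symmetric and transitive, and it holds locally, so connectedness of
`K` spreads it to all pairs. Finally the shift, which may be negative, is replaced by a
reparametrization of the half line asymptotic to it. -/

/-! ### Uniform estimates from compactness. -/

section Compactness

variable {E F : Type*} [NormedAddCommGroup E] [NormedSpace ℝ E]
  [NormedAddCommGroup F] [NormedSpace ℝ F]

/-- A `C^1` map is strictly differentiable uniformly on compact sets. -/
theorem exists_uniform_strict_differentiability_of_contDiffOn {Ω S : Set E} {φ : E → F}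
    (hφ : ContDiffOn ℝ 1 φ Ω) (hΩ : IsOpen Ω) (hS : IsCompact S) (hSΩ : S ⊆ Ω)
    {ε : ℝ} (hε : 0 < ε) :
    ∃ r > 0, ∀ z ∈ S, ∀ a b, dist a z < r → dist b z < r →
      ‖φ a - φ b - fderiv ℝ φ z (a - b)‖ ≤ ε * ‖a - b‖ := by
  have key : ∀ᶠ r in 𝓝 (0 : ℝ), ∀ z ∈ S, ∀ a b, dist a z < r → dist b z < r →
      ‖φ a - φ b - fderiv ℝ φ z (a - b)‖ ≤ ε * ‖a - b‖ := by
    refine hS.eventually_forall_of_forall_eventually fun z₀ hz₀ => ?_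
    have hz₀' : Ω ∈ 𝓝 z₀ := hΩ.mem_nhds (hSΩ hz₀)
    have h1 : HasStrictFDerivAt φ (fderiv ℝ φ z₀) z₀ :=
      (hφ.contDiffAt hz₀').hasStrictFDerivAt (by simp)
    have h2 : ContinuousAt (fderiv ℝ φ) z₀ :=
      (hφ.continuousOn_fderiv_of_isOpen hΩ le_rfl).continuousAt hz₀'
    have h3 := h1.isLittleO.def (half_pos hε)
    rw [nhds_prod_eq] at h3
    obtain ⟨r, hr, h3⟩ := (Metric.nhds_basis_ball.prod_self.eventually_iff).1 h3
    have h4 : ∀ᶠ z in 𝓝 z₀, ‖fderiv ℝ φ z - fderiv ℝ φ z₀‖ ≤ ε / 2 := by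
      filter_upwards [Metric.tendsto_nhds.1 h2 _ (half_pos hε)] with z hz
      rw [dist_eq_norm] at hz
      exact hz.le
    rw [nhds_prod_eq]
    filter_upwards [(eventually_lt_nhds (half_pos hr)).prod_mk
      (h4.and (Metric.ball_mem_nhds z₀ (half_pos hr)))] with p hp a b ha hb
    obtain ⟨hp1, hp2, hp3⟩ := hp
    have ha' : a ∈ Metric.ball z₀ r := by
      rw [Metric.mem_ball]; linarith [dist_triangle a p.2 z₀]
    have hb' : b ∈ Metric.ball z₀ r := by
      rw [Metric.mem_ball]; linarith [dist_triangle b p.2 z₀]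
    have h5 : ‖φ a - φ b - fderiv ℝ φ z₀ (a - b)‖ ≤ ε / 2 * ‖a - b‖ :=
      h3 (x := (a, b)) ⟨ha', hb'⟩
    calc ‖φ a - φ b - fderiv ℝ φ p.2 (a - b)‖
        = ‖(φ a - φ b - fderiv ℝ φ z₀ (a - b))
            - (fderiv ℝ φ p.2 - fderiv ℝ φ z₀) (a - b)‖ := by
          rw [_root_.sub_apply]; congr 1; abel
      _ ≤ ε / 2 * ‖a - b‖ + ε / 2 * ‖a - b‖ :=
          (norm_sub_le _ _).trans (add_le_add h5
            (((fderiv ℝ φ p.2 - fderiv ℝ φ z₀).le_opNorm _).trans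
              (mul_le_mul_of_nonneg_right hp2 (norm_nonneg _))))
      _ = ε * ‖a - b‖ := by ring
  have := (key.filter_mono nhdsWithin_le_nhds).and
    (self_mem_nhdsWithin (a := (0 : ℝ)) (s := Ioi 0))
  obtain ⟨r, h, hr⟩ := this.exists
  exact ⟨r, hr, h⟩

theorem IsCompact.exists_pos_forall_le {X : Type*} [TopologicalSpace X] {S : Set X}
    (hS : IsCompact S) {φ : X → ℝ} (hφ : ContinuousOn φ S) (hpos : ∀ z ∈ S, 0 < φ z) :
    ∃ m > 0, ∀ z ∈ S, m ≤ φ z := by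
  rcases S.eq_empty_or_nonempty with rfl | hne
  · exact ⟨1, one_pos, by simp⟩
  · obtain ⟨z, hz, hmin⟩ := hS.exists_isMinOn hne hφ
    exact ⟨φ z, hpos z hz, fun w hw => hmin hw⟩

theorem IsCompact.exists_nonneg_forall_norm_le {X G : Type*} [TopologicalSpace X]
    [SeminormedAddCommGroup G] {S : Set X} (hS : IsCompact S) {φ : X → G} (hφ : ContinuousOn φ S) :
    ∃ C, 0 ≤ C ∧ ∀ z ∈ S, ‖φ z‖ ≤ C := by
  obtain ⟨C, hC⟩ := hS.exists_bound_of_continuousOn hφ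
  exact ⟨max C 0, le_max_right _ _, fun z hz => (hC z hz).trans (le_max_left _ _)⟩

/-- If `P < 0` wherever the nonnegative penalty `Q` vanishes on a compact set, then a large
multiple of `Q` dominates `P`. -/
theorem IsCompact.exists_le_mul_of_neg_on_zeros {X : Type*} [TopologicalSpace X] {S : Set X}
    (hS : IsCompact S) {P Q : X → ℝ} (hP : ContinuousOn P S) (hQ : ContinuousOn Q S)
    (hQ0 : ∀ z ∈ S, 0 ≤ Q z) (hPQ : ∀ z ∈ S, Q z = 0 → P z < 0) :
    ∃ k, 0 ≤ k ∧ ∀ z ∈ S, P z ≤ k * Q z := by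
  -- Where `P ≥ 0` the penalty cannot vanish, so there it is at least some `m > 0`, and `C / m` with
  -- `C` a bound for `P` suffices. Elsewhere any nonnegative gain works.
  have hT : IsCompact (S ∩ P ⁻¹' Ici 0) := by
    obtain ⟨u, hu, hSu⟩ := continuousOn_iff_isClosed.1 hP _ isClosed_Ici
    rw [inter_comm, hSu]
    exact hS.inter_left hu
  obtain ⟨m, hm, hmQ⟩ := hT.exists_pos_forall_le (hQ.mono inter_subset_left) fun z hz =>
    (hQ0 z hz.1).lt_of_ne fun h => (hPQ z hz.1 h.symm).not_ge hz.2
  obtain ⟨C, hC, hCP⟩ := hS.exists_nonneg_forall_norm_le hP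
  refine ⟨C / m, by positivity, fun z hz => ?_⟩
  rcases lt_or_ge (P z) 0 with h | h
  · exact h.le.trans (mul_nonneg (by positivity) (hQ0 z hz))
  · calc P z ≤ C := (le_abs_self _).trans (hCP z hz)
      _ = C / m * m := by field_simp
      _ ≤ C / m * Q z := by gcongr; exact hmQ z ⟨hz, h⟩

end Compactness

theorem eventually_mul_lt_of_pos (c : ℝ) {ε : ℝ} (hε : 0 < ε) :
    ∀ᶠ h in 𝓝[>] (0 : ℝ), c * h < ε := by
  have : Tendsto (fun h : ℝ => c * h) (𝓝 0) (𝓝 (c * 0)) := tendsto_id.const_mul c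
  rw [mul_zero] at this
  exact (this.eventually_lt_const hε).filter_mono nhdsWithin_le_nhds

section MeanValue

variable {E : Type*} [NormedAddCommGroup E] [NormedSpace ℝ E]

/-- Mean value inequality for `u r - r • v`. The choice `v = 0` gives Lipschitz bounds, and `v` the
initial velocity gives first order expansions. -/
theorem norm_sub_sub_smul_le_of_hasDerivWithinAt {u u' : ℝ → E} {v : E} {C T s t : ℝ}
    (hu : ∀ r ∈ Icc 0 T, HasDerivWithinAt u (u' r) (Icc 0 T) r)
    (hC : ∀ r ∈ Icc 0 T, ‖u' r - v‖ ≤ C) (hs : s ∈ Icc 0 T) (ht : t ∈ Icc 0 T) :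
    ‖u t - u s - (t - s) • v‖ ≤ C * |t - s| := by
  have := Convex.norm_image_sub_le_of_norm_hasDerivWithin_le (f := fun r => u r - r • v)
    (f' := fun r => u' r - v) (s := Icc 0 T) (C := C) (x := s) (y := t)
    (fun r hr => by
      simpa using (hu r hr).fun_sub ((hasDerivWithinAt_id r _).smul_const v)) hC
    (convex_Icc _ _) hs ht
  rw [Real.norm_eq_abs] at this
  convert this using 2
  rw [sub_smul]; abel

end MeanValue

/-! ### Estimates for solutions confined to `K`, which takes the place of the domain in
`IsSolutionOn`. -/

section Solutions

variable {n : ℕ} {K : Set (EuclideanSpace ℝ (Fin n))}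
  {f : EuclideanSpace ℝ (Fin n) → EuclideanSpace ℝ (Fin n)} {x y : ℝ → EuclideanSpace ℝ (Fin n)}

theorem IsSolutionOn.mono {I J : Set ℝ} (hx : IsSolutionOn K f I x) (hJ : J ⊆ I) :
    IsSolutionOn K f J x :=
  fun t ht => ⟨(hx t (hJ ht)).1, (hx t (hJ ht)).2.mono hJ⟩

theorem IsSolutionOn.comp_const_add {I J : Set ℝ} {a : ℝ} (hx : IsSolutionOn K f I x)
    (hJ : MapsTo (fun t => a + t) J I) : IsSolutionOn K f J (fun t => x (a + t)) := by
  intro t ht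
  refine ⟨(hx _ (hJ ht)).1, ?_⟩
  have := (hx _ (hJ ht)).2.scomp t ((hasDerivWithinAt_id t J).const_add a) hJ
  rwa [one_smul] at this

theorem IsSolutionOn.shift (hx : IsSolutionOn K f (Ici 0) x) {a : ℝ} (ha : 0 ≤ a) :
    IsSolutionOn K f (Ici 0) (fun t => x (a + t)) :=
  hx.comp_const_add fun _ ht => add_nonneg ha ht

theorem IsSolutionOn.norm_sub_sub_smul_le (hx : IsSolutionOn K f (Ici 0) x)
    {v : EuclideanSpace ℝ (Fin n)} {C T s t : ℝ}
    (hC : ∀ r ∈ Icc 0 T, ‖f (x r) - v‖ ≤ C) (hs : s ∈ Icc 0 T) (ht : t ∈ Icc 0 T) :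
    ‖x t - x s - (t - s) • v‖ ≤ C * |t - s| :=
  norm_sub_sub_smul_le_of_hasDerivWithinAt
    (fun r hr => ((hx.mono Icc_subset_Ici_self) r hr).2) hC hs ht

theorem IsSolutionOn.norm_sub_le (hx : IsSolutionOn K f (Ici 0) x) {M : ℝ}
    (hM : ∀ z ∈ K, ‖f z‖ ≤ M) {s t : ℝ} (hs : 0 ≤ s) (ht : 0 ≤ t) :
    ‖x t - x s‖ ≤ M * |t - s| := by
  have := hx.norm_sub_sub_smul_le (v := 0) (T := max s t) (s := s) (t := t) (C := M)
    (fun r hr => by simpa using hM _ (hx r hr.1).1) ⟨hs, le_max_left _ _⟩ ⟨ht, le_max_right _ _⟩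
  simpa using this

theorem IsSolutionOn.norm_sub_le_exp (hx : IsSolutionOn K f (Ici 0) x)
    (hy : IsSolutionOn K f (Ici 0) y) {L : NNReal} (hL : LipschitzOnWith L f K) {t : ℝ}
    (ht : 0 ≤ t) : ‖y t - x t‖ ≤ ‖y 0 - x 0‖ * Real.exp (L * t) := by
  have H : ∀ z, IsSolutionOn K f (Ici 0) z → ContinuousOn z (Icc 0 t) ∧
      ∀ r ∈ Ico 0 t, HasDerivWithinAt z (f (z r)) (Ici r) r := fun z hz =>
    ⟨fun r hr => ((hz r hr.1).2.continuousWithinAt).mono Icc_subset_Ici_self,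
      fun r hr => (hz r hr.1).2.mono (Ici_subset_Ici.2 hr.1)⟩
  have := dist_le_of_trajectories_ODE_of_mem (v := fun _ => f) (s := fun _ => K) (K := L)
    (a := 0) (b := t) (f := y) (g := x) (δ := ‖y 0 - x 0‖) (fun _ _ => hL)
    (H y hy).1 (H y hy).2 (fun r hr => (hy r hr.1).1) (H x hx).1 (H x hx).2
    (fun r hr => (hx r hr.1).1) (dist_eq_norm _ _).le t ⟨ht, le_rfl⟩
  simpa [dist_eq_norm] using this

/-- First order expansion in time of the difference of two solutions, uniform in the solutions
and relative to their initial distance. -/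
theorem exists_forall_norm_solution_sub_le {U : Set (EuclideanSpace ℝ (Fin n))}
    (hU : IsOpen U) (hK : IsCompact K)
    (hKU : K ⊆ U) (hf : ContDiffOn ℝ 1 f U) {L : NNReal} (hL : LipschitzOnWith L f K)
    {ε : ℝ} (hε : 0 < ε) :
    ∀ᶠ h in 𝓝[>] (0 : ℝ), ∃ ρ₀ > 0, ∀ x y, IsSolutionOn K f (Ici 0) x →
      IsSolutionOn K f (Ici 0) y → ‖y 0 - x 0‖ ≤ ρ₀ →
      ‖y h - x h - (y 0 - x 0) - h • fderiv ℝ f (x 0) (y 0 - x 0)‖ ≤ ε * ‖y 0 - x 0‖ * h := by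
  obtain ⟨M, hM0, hM⟩ := hK.exists_nonneg_forall_norm_le (hf.continuousOn.mono hKU)
  obtain ⟨N, hN0, hN⟩ := hK.exists_nonneg_forall_norm_le
    ((hf.continuousOn_fderiv_of_isOpen hU le_rfl).mono hKU)
  set e := Real.exp L with he
  have he0 : 0 < e := Real.exp_pos _
  -- Half of `ε` pays for linearising `f` at `x 0`, where `e` is the Grönwall growth up to time 1.
  -- The other half pays for the drift of `y - x` during time `h`, which is the bound on `N * (L *
  -- e) * h` below.
  obtain ⟨r, hr, hstrict⟩ := exists_uniform_strict_differentiability_of_contDiffOn hf hU hK hKU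
    (ε := ε / (2 * e)) (by positivity)
  filter_upwards [eventually_mul_lt_of_pos 1 one_pos, eventually_mul_lt_of_pos M (half_pos hr),
    eventually_mul_lt_of_pos (N * (L * e)) (half_pos hε), self_mem_nhdsWithin]
    with h h1 h2 h3 (h0 : 0 < h)
  refine ⟨r / 2, half_pos hr, fun x y hx hy hρ => ?_⟩
  set ρ := ‖y 0 - x 0‖ with hρdef
  have hxy : ∀ t ∈ Icc 0 h, ‖y t - x t‖ ≤ ρ * e := fun t ht => by
    refine (hx.norm_sub_le_exp hy hL ht.1).trans ?_
    gcongr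
    refine Real.exp_le_exp.2 ?_
    have : t ≤ 1 := by linarith [ht.2]
    exact mul_le_of_le_one_right L.2 this
  have hder : ∀ t ∈ Icc 0 h, HasDerivWithinAt (fun t => y t - x t) (f (y t) - f (x t))
      (Icc 0 h) t := fun t ht =>
    (((hy.mono Icc_subset_Ici_self) t ht).2).fun_sub (((hx.mono Icc_subset_Ici_self) t ht).2)
  have hx0 : x 0 ∈ K := (hx 0 self_mem_Ici).1
  have hlin : ∀ t ∈ Icc 0 h, ‖y t - x t - (y 0 - x 0)‖ ≤ L * e * ρ * h := fun t ht => by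
    have := norm_sub_sub_smul_le_of_hasDerivWithinAt (v := 0) (C := L * e * ρ) hder
      (fun t ht => by
        rw [sub_zero]
        refine (hL.norm_sub_le (hy t ht.1).1 (hx t ht.1).1).trans ?_
        calc (L : ℝ) * ‖y t - x t‖ ≤ L * (ρ * e) := by gcongr; exact hxy t ht
          _ = L * e * ρ := by ring) ⟨le_rfl, h0.le⟩ ht
    simp only [smul_zero, sub_zero] at this
    refine this.trans ?_
    rw [abs_of_nonneg ht.1]
    gcongr
    exact ht.2
  have hbd : ∀ t ∈ Icc 0 h, ‖f (y t) - f (x t) - fderiv ℝ f (x 0) (y 0 - x 0)‖ ≤ ε * ρ := by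
    intro t ht
    have hMt : M * t ≤ M * h := by gcongr; exact ht.2
    have hxt : dist (x t) (x 0) < r := by
      have := hx.norm_sub_le hM le_rfl ht.1
      rw [sub_zero, abs_of_nonneg ht.1] at this
      rw [dist_eq_norm]; linarith
    have hyt : dist (y t) (x 0) < r := by
      have := hy.norm_sub_le hM le_rfl ht.1
      rw [sub_zero, abs_of_nonneg ht.1] at this
      have h5 := norm_sub_le_norm_sub_add_norm_sub (y t) (y 0) (x 0)
      rw [dist_eq_norm]; linarith
    have h6 := hstrict (x 0) hx0 _ _ hyt hxt
    calc ‖f (y t) - f (x t) - fderiv ℝ f (x 0) (y 0 - x 0)‖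
        = ‖(f (y t) - f (x t) - fderiv ℝ f (x 0) (y t - x t))
          + fderiv ℝ f (x 0) (y t - x t - (y 0 - x 0))‖ := by
          rw [map_sub _ (y t - x t)]; congr 1; abel
      _ ≤ ε / (2 * e) * (ρ * e) + N * (L * e * ρ * h) := by
          refine (norm_add_le _ _).trans (add_le_add (h6.trans ?_)
            (((fderiv ℝ f (x 0)).le_opNorm _).trans ?_))
          · gcongr; exact hxy t ht
          · gcongr
            · exact hN _ hx0
            · exact hlin t ht
      _ = ε / 2 * ρ + (N * (L * e) * h) * ρ := by field_simp
      _ ≤ ε / 2 * ρ + ε / 2 * ρ := by gcongr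
      _ = ε * ρ := by ring
  have := norm_sub_sub_smul_le_of_hasDerivWithinAt hder hbd ⟨le_rfl, h0.le⟩ ⟨h0.le, le_rfl⟩
  rwa [sub_zero, abs_of_pos h0] at this

end Solutions

/-! ### Infinitesimal contraction and its discretisation. -/

section Finsler

variable {n : ℕ} {U K : Set (EuclideanSpace ℝ (Fin n))}
  {f : EuclideanSpace ℝ (Fin n) → EuclideanSpace ℝ (Fin n)}
  {V : EuclideanSpace ℝ (Fin n) → EuclideanSpace ℝ (Fin n) → ℝ} {lam : ℝ}

theorem IsFinslerFunction.apply_zero (hV : IsFinslerFunction U V)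
    {x : EuclideanSpace ℝ (Fin n)} (hx : x ∈ U) : V x 0 = 0 := by
  simpa using hV.homogeneous x hx 0 0 le_rfl

theorem prod_sphere_subset_prod_compl_zero (hKU : K ⊆ U) :
    K ×ˢ Metric.sphere (0 : EuclideanSpace ℝ (Fin n)) 1 ⊆ U ×ˢ {0}ᶜ := by
  rintro ⟨x, u⟩ ⟨hx, hu⟩
  refine ⟨hKU hx, fun h : u = 0 => ?_⟩
  subst h
  simp at hu

theorem IsCompact.prod_sphere (hK : IsCompact K) :
    IsCompact (K ×ˢ Metric.sphere (0 : EuclideanSpace ℝ (Fin n)) 1) :=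
  hK.prod (isCompact_sphere _ _)

theorem inv_norm_smul_mem_sphere {δ : EuclideanSpace ℝ (Fin n)} (hδ : δ ≠ 0) :
    ‖δ‖⁻¹ • δ ∈ Metric.sphere (0 : EuclideanSpace ℝ (Fin n)) 1 := by
  simp [norm_smul, hδ]

theorem IsFinslerFunction.eq_norm_mul (hV : IsFinslerFunction U V)
    {x : EuclideanSpace ℝ (Fin n)} (hx : x ∈ U) {δ : EuclideanSpace ℝ (Fin n)} (hδ : δ ≠ 0) :
    V x δ = ‖δ‖ * V x (‖δ‖⁻¹ • δ) := by
  rw [← hV.homogeneous x hx _ _ (norm_nonneg _), smul_inv_smul₀ (norm_ne_zero_iff.2 hδ)]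

theorem IsFinslerFunction.exists_norm_bounds (hV : IsFinslerFunction U V) (hK : IsCompact K)
    (hKU : K ⊆ U) :
    ∃ m > 0, ∃ C, 0 ≤ C ∧ ∀ x ∈ K, ∀ δ, m * ‖δ‖ ≤ V x δ ∧ V x δ ≤ C * ‖δ‖ := by
  have hcont := hV.contDiffOn.continuousOn.mono (prod_sphere_subset_prod_compl_zero hKU)
  obtain ⟨m, hm, hmV⟩ := hK.prod_sphere.exists_pos_forall_le hcont fun z hz =>
    hV.pos _ (hKU hz.1) _ (prod_sphere_subset_prod_compl_zero hKU hz).2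
  obtain ⟨C, hC, hCV⟩ := hK.prod_sphere.exists_nonneg_forall_norm_le hcont
  refine ⟨m, hm, C, hC, fun x hx δ => ?_⟩
  rcases eq_or_ne δ 0 with rfl | hδ
  · simp [hV.apply_zero (hKU hx)]
  · have hz : (x, ‖δ‖⁻¹ • δ) ∈ K ×ˢ Metric.sphere (0 : EuclideanSpace ℝ (Fin n)) 1 :=
      ⟨hx, inv_norm_smul_mem_sphere hδ⟩
    rw [hV.eq_norm_mul (hKU hx) hδ, mul_comm m, mul_comm C]
    exact ⟨mul_le_mul_of_nonneg_left (hmV _ hz) (norm_nonneg _),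
      mul_le_mul_of_nonneg_left ((le_abs_self _).trans (hCV _ hz)) (norm_nonneg _)⟩

/-- Partial derivatives are expressed through the total derivative of `V`, whose joint continuity is
what the compactness arguments use. -/
theorem IsFinslerFunction.fderiv_right (hV : IsFinslerFunction U V) (hU : IsOpen U)
    {x δ : EuclideanSpace ℝ (Fin n)} (hx : x ∈ U) (hδ : δ ≠ 0) (v : EuclideanSpace ℝ (Fin n)) :
    fderiv ℝ (fun w => V x w) δ v = fderiv ℝ (fun p : _ × _ => V p.1 p.2) (x, δ) (0, v) := by
  have hd := ((hV.contDiffOn.contDiffAt ((hU.prod isOpen_compl_singleton).mem_nhds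
    (show (x, δ) ∈ U ×ˢ {0}ᶜ from ⟨hx, hδ⟩))).differentiableAt one_ne_zero).hasFDerivAt
  have := hd.comp δ (hasFDerivAt_prodMk_right x δ)
  rw [HasFDerivAt.fderiv (f := fun w => V x w) this]
  simp

theorem IsFinslerFunction.fderiv_left (hV : IsFinslerFunction U V) (hU : IsOpen U)
    {x δ : EuclideanSpace ℝ (Fin n)} (hx : x ∈ U) (hδ : δ ≠ 0) (v : EuclideanSpace ℝ (Fin n)) :
    fderiv ℝ (fun y => V y δ) x v = fderiv ℝ (fun p : _ × _ => V p.1 p.2) (x, δ) (v, 0) := by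
  have hd := ((hV.contDiffOn.contDiffAt ((hU.prod isOpen_compl_singleton).mem_nhds
    (show (x, δ) ∈ U ×ˢ {0}ᶜ from ⟨hx, hδ⟩))).differentiableAt one_ne_zero).hasFDerivAt
  have := HasFDerivAt.comp (f := fun y => (y, δ)) x hd (hasFDerivAt_prodMk_left x δ)
  rw [HasFDerivAt.fderiv (f := fun y => V y δ) this]
  simp

/-- Transverse contraction turned into contraction along a feedback that slows down or speeds up
the motion: `k` is a gain that is uniform over `K`, equilibria included. -/
theorem TransverselyContracting.exists_gain (hcontr : TransverselyContracting f K V lam)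
    (hV : IsFinslerFunction U V) (hU : IsOpen U) (hK : IsCompact K) (hKU : K ⊆ U)
    (hf : ContDiffOn ℝ 1 f U) (hlam : 0 < lam) :
    ∃ k, 0 ≤ k ∧ ∀ x ∈ K, ∀ u ∈ Metric.sphere (0 : EuclideanSpace ℝ (Fin n)) 1,
      fderiv ℝ (fun p : _ × _ => V p.1 p.2) (x, u) (f x, fderiv ℝ f x u -
        (k * fderiv ℝ (fun p : _ × _ => V p.1 p.2) (x, u) (0, f x)) • f x)
      ≤ -(lam / 2) * V x u := by
  set F := fun p : EuclideanSpace ℝ (Fin n) × EuclideanSpace ℝ (Fin n) => V p.1 p.2 with hF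
  set S := K ×ˢ Metric.sphere (0 : EuclideanSpace ℝ (Fin n)) 1 with hS
  have hSΩ : S ⊆ U ×ˢ {0}ᶜ := prod_sphere_subset_prod_compl_zero hKU
  have hDF : ContinuousOn (fderiv ℝ F) S :=
    (hV.contDiffOn.continuousOn_fderiv_of_isOpen (hU.prod isOpen_compl_singleton) le_rfl).mono hSΩ
  have hfS : ContinuousOn (fun z : EuclideanSpace ℝ (Fin n) × EuclideanSpace ℝ (Fin n) => f z.1)
      S := (hf.continuousOn.mono hKU).comp continuousOn_fst fun z hz => hz.1
  have hAS : ContinuousOn (fun z : EuclideanSpace ℝ (Fin n) × EuclideanSpace ℝ (Fin n) =>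
      fderiv ℝ f z.1 z.2) S :=
    (((hf.continuousOn_fderiv_of_isOpen hU le_rfl).mono hKU).comp continuousOn_fst
      fun z hz => hz.1).clm_apply continuousOn_snd
  have hFS : ContinuousOn F S := hV.contDiffOn.continuousOn.mono hSΩ
  -- The feedback contributes `-k * Q`, with `Q` the square of `∂V/∂δ f`. Giving up half of the rate
  -- makes `P` strictly negative on the zeros of `Q`.
  obtain ⟨k, hk, H⟩ := hK.prod_sphere.exists_le_mul_of_neg_on_zeros
    (P := fun z => fderiv ℝ F z (f z.1, fderiv ℝ f z.1 z.2) + lam / 2 * F z)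
    (Q := fun z => (fderiv ℝ F z (0, f z.1)) ^ 2)
    ((hDF.clm_apply (hfS.prodMk hAS)).add (continuousOn_const.mul hFS))
    ((hDF.clm_apply (continuousOn_const.prodMk hfS)).pow 2) (fun z _ => sq_nonneg _)
    (by
      rintro ⟨x, u⟩ hz hQ
      have hx := (hSΩ hz).1
      have hu : u ≠ 0 := (hSΩ hz).2
      have h0 : fderiv ℝ F (x, u) (0, f x) = 0 := by simpa using hQ
      have := hcontr x hz.1 u hu (by rw [hV.fderiv_right hU hx hu]; exact h0)
      rw [hV.fderiv_right hU hx hu, hV.fderiv_left hU hx hu, ← map_add] at this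
      simp only [Prod.mk_add_mk, add_zero, zero_add] at this
      have hpos := mul_pos hlam (hV.pos x hx u hu)
      simp only [hF] at this ⊢
      linarith)
  refine ⟨k, hk, fun x hx u hu => ?_⟩
  have h1 := H (x, u) ⟨hx, hu⟩
  simp only at h1
  set a := fderiv ℝ F (x, u) (0, f x) with ha
  have h2 : (f x, fderiv ℝ f x u - (k * a) • f x)
      = (f x, fderiv ℝ f x u) - (k * a) • ((0 : EuclideanSpace ℝ (Fin n)), f x) := by simp
  rw [h2, map_sub, map_smul, ← ha, smul_eq_mul]
  simp only [hF] at h1 ⊢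
  linarith

/-- A pair of nearby solutions contracts by a fixed factor over a fixed time step of the first one,
if the time step of the second one is chosen suitably. -/
theorem TransverselyContracting.exists_step (hcontr : TransverselyContracting f K V lam)
    (hV : IsFinslerFunction U V) (hU : IsOpen U) (hK : IsCompact K) (hKU : K ⊆ U)
    (hf : ContDiffOn ℝ 1 f U) (hlam : 0 < lam) {L : NNReal} (hL : LipschitzOnWith L f K) :
    ∃ h > 0, ∃ ρ₀ > 0, ∃ q, 0 ≤ q ∧ q < 1 ∧ ∃ c, 0 ≤ c ∧
      ∀ x y, IsSolutionOn K f (Ici 0) x → IsSolutionOn K f (Ici 0) y → ‖y 0 - x 0‖ ≤ ρ₀ →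
        ∃ μ, 0 ≤ μ ∧ |μ - h| ≤ c * ‖y 0 - x 0‖ ∧
          V (x h) (y μ - x h) ≤ q * V (x 0) (y 0 - x 0) := by
  set F := fun p : EuclideanSpace ℝ (Fin n) × EuclideanSpace ℝ (Fin n) => V p.1 p.2 with hF
  set S := K ×ˢ Metric.sphere (0 : EuclideanSpace ℝ (Fin n)) 1 with hS
  have hSΩ : S ⊆ U ×ˢ {0}ᶜ := prod_sphere_subset_prod_compl_zero hKU
  have hΩ : IsOpen (U ×ˢ ({0}ᶜ : Set (EuclideanSpace ℝ (Fin n)))) :=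
    hU.prod isOpen_compl_singleton
  obtain ⟨k, hk, hgain⟩ := hcontr.exists_gain hV hU hK hKU hf hlam
  obtain ⟨m, hm, _, _, hmV⟩ := hV.exists_norm_bounds hK hKU
  obtain ⟨M, hM0, hM⟩ := hK.exists_nonneg_forall_norm_le (hf.continuousOn.mono hKU)
  obtain ⟨A, hA0, hA⟩ := hK.exists_nonneg_forall_norm_le
    ((hf.continuousOn_fderiv_of_isOpen hU le_rfl).mono hKU)
  obtain ⟨N, hN0, hN⟩ := hK.prod_sphere.exists_nonneg_forall_norm_le
    ((hV.contDiffOn.continuousOn_fderiv_of_isOpen hΩ le_rfl).mono hSΩ)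
  set B := N * M with hB
  have hB0 : 0 ≤ B := mul_nonneg hN0 hM0
  set R := M + (A + k * B * M) with hR
  have hR0 : 0 ≤ R := by positivity
  -- Error budget: the gain yields a decrease of `lam / 2 * h * V`. Nonlinearity of `V` and the
  -- displacement error (through `N * η`) cost `lam * m / 8 * h` each, and `m ≤ V` on unit vectors
  -- leaves `lam / 4 * h * V`.
  obtain ⟨r, hr, hstrict⟩ := exists_uniform_strict_differentiability_of_contDiffOn hV.contDiffOn hΩ
    hK.prod_sphere hSΩ (ε := lam * m / (8 * (R + 1))) (by positivity)
  set η := min 1 (lam * m / (8 * (N + 1))) with hη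
  have hη0 : 0 < η := lt_min one_pos (by positivity)
  have hη1 : η ≤ 1 := min_le_left _ _
  have hη2 : N * η ≤ lam * m / 8 := by
    calc N * η ≤ (N + 1) * (lam * m / (8 * (N + 1))) := by
          gcongr
          · linarith
          · exact min_le_right _ _
      _ = lam * m / 8 := by field_simp
  obtain ⟨h, ⟨ρ₁, hρ₁, hexp⟩, h1, h2, h3, h4, (h0 : 0 < h)⟩ :=
    ((exists_forall_norm_solution_sub_le hU hK hKU hf hL (half_pos hη0)).and
    ((eventually_mul_lt_of_pos (R + 1) hr).and ((eventually_mul_lt_of_pos (L * M) hη0).and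
    ((eventually_mul_lt_of_pos (k * B * (L * (2 * M))) (half_pos (half_pos hη0))).and
    ((eventually_mul_lt_of_pos lam one_pos).and self_mem_nhdsWithin))))).exists
  obtain ⟨ρ₂, h5, h6, (h7 : 0 < ρ₂)⟩ :=
    ((eventually_mul_lt_of_pos (k * B) one_pos).and
    ((eventually_mul_lt_of_pos (k * B * L) (half_pos (half_pos hη0))).and
      self_mem_nhdsWithin)).exists
  refine ⟨h, h0, min ρ₁ ρ₂, lt_min hρ₁ h7, 1 - lam * h / 4, by linarith,
    by have := mul_pos hlam h0; linarith, h * (k * B), by positivity,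
    fun x y hx hy hρ => ?_⟩
  have hx0 : x 0 ∈ K := (hx 0 self_mem_Ici).1
  have hxh : x h ∈ K := (hx h h0.le).1
  rcases eq_or_ne (y 0 - x 0) 0 with hδ | hδ
  · refine ⟨h, h0.le, by simp [hδ], ?_⟩
    have : ‖y h - x h‖ ≤ 0 := by simpa [hδ] using hx.norm_sub_le_exp hy hL h0.le
    rw [norm_le_zero_iff.1 this, hδ, hV.apply_zero (hKU hx0), hV.apply_zero (hKU hxh), mul_zero]
  set ρ := ‖y 0 - x 0‖ with hρdef
  have hρ0 : 0 < ρ := norm_pos_iff.2 hδ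
  set u := ρ⁻¹ • (y 0 - x 0) with hu
  have huS : u ∈ Metric.sphere (0 : EuclideanSpace ℝ (Fin n)) 1 := inv_norm_smul_mem_sphere hδ
  have hu1 : ‖u‖ = 1 := by simpa using huS
  have hz : (x 0, u) ∈ S := ⟨hx0, huS⟩
  set a := fderiv ℝ F (x 0, u) (0, f (x 0)) with ha
  have haB : |a| ≤ B := by
    refine ((fderiv ℝ F (x 0, u)).le_opNorm _).trans ?_
    rw [Prod.norm_mk, norm_zero, max_eq_right (norm_nonneg _)]
    exact mul_le_mul (hN _ hz) (hM _ hx0) (norm_nonneg _) hN0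
  have hka : |k * a| ≤ k * B := by
    rw [abs_mul, abs_of_nonneg hk]; gcongr
  have hkρ : k * B * ρ ≤ k * B * ρ₂ := by gcongr; exact hρ.trans (min_le_right _ _)
  have hkaρ : |k * a * ρ| ≤ k * B * ρ := by
    rw [abs_mul, abs_of_pos hρ0]; gcongr
  -- The feedback in discrete form: changing the running time of `y` by `-h * k * a * ρ` moves it by
  -- about that multiple of `f (x 0)`, which after division by `ρ` is the term `-(k * a) • f (x 0)`
  -- of `w`, times `h`.
  set μ := h - h * (k * a * ρ) with hμ
  have hμh : |μ - h| ≤ h * (k * B * ρ) := by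
    rw [hμ, sub_sub_cancel_left, abs_neg, abs_mul, abs_of_pos h0]; gcongr
  have hμh' : h * (k * B * ρ) ≤ h := mul_le_of_le_one_right h0.le (by linarith)
  have hμ0 : 0 ≤ μ := by linarith [neg_le_of_abs_le (hμh.trans hμh')]
  have hμ2 : μ ≤ 2 * h := by linarith [le_of_abs_le (hμh.trans hμh')]
  refine ⟨μ, hμ0, hμh.trans_eq (by ring), ?_⟩
  set w := fderiv ℝ f (x 0) u - (k * a) • f (x 0) with hw
  -- the displacement of the normalized pair, compared with its first order approximation
  have e1 : ‖x h - x 0 - h • f (x 0)‖ ≤ η * h := by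
    have := hx.norm_sub_sub_smul_le (v := f (x 0)) (T := h) (C := L * (M * h)) (fun s hs => by
      refine (hL.norm_sub_le (hx s hs.1).1 hx0).trans ?_
      have := hx.norm_sub_le hM le_rfl hs.1
      rw [sub_zero, abs_of_nonneg hs.1] at this
      have h8 : M * s ≤ M * h := by gcongr; exact hs.2
      gcongr; linarith) ⟨le_rfl, h0.le⟩ ⟨h0.le, le_rfl⟩
    rw [sub_zero, abs_of_pos h0] at this
    refine this.trans ?_
    gcongr
    linarith
  have e2 : ‖y h - x h - (y 0 - x 0) - h • fderiv ℝ f (x 0) (y 0 - x 0)‖ ≤ η / 2 * ρ * h :=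
    hexp x y hx hy (hρ.trans (min_le_left _ _))
  -- The error is a product of two small factors: the deviation `L * (ρ + 2 * M * h)` of the
  -- velocity of `y` from `f (x 0)`, and the time change, itself of order `ρ * h`.
  have e3 : ‖y μ - y h - (μ - h) • f (x 0)‖ ≤ η / 2 * ρ * h := by
    have := hy.norm_sub_sub_smul_le (v := f (x 0)) (T := 2 * h) (C := L * (ρ + 2 * M * h))
      (s := h) (t := μ) (fun s hs => by
      refine (hL.norm_sub_le (hy s hs.1).1 hx0).trans ?_
      have := hy.norm_sub_le hM le_rfl hs.1
      rw [sub_zero, abs_of_nonneg hs.1] at this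
      have h8 : M * s ≤ M * (2 * h) := by gcongr; exact hs.2
      have h9 := norm_sub_le_norm_sub_add_norm_sub (y s) (y 0) (x 0)
      gcongr; linarith) ⟨h0.le, by linarith⟩ ⟨hμ0, hμ2⟩
    refine this.trans ?_
    calc L * (ρ + 2 * M * h) * |μ - h| ≤ L * (ρ + 2 * M * h) * (h * (k * B * ρ)) := by gcongr
      _ = (k * B * L * ρ + k * B * (L * (2 * M)) * h) * (ρ * h) := by ring
      _ ≤ (η / 2 / 2 + η / 2 / 2) * (ρ * h) := by
          have : k * B * L * ρ ≤ k * B * L * ρ₂ := by gcongr; exact hρ.trans (min_le_right _ _)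
          gcongr; linarith
      _ = η / 2 * ρ * h := by ring
  -- Normalised by the old distance, so `u'` need not be a unit vector; homogeneity then puts the
  -- same factor `ρ` on both sides of the final estimate.
  set u' := ρ⁻¹ • (y μ - x h) with hu'
  have e4 : ‖u' - u - h • w‖ ≤ η * h := by
    have : u' - u - h • w = ρ⁻¹ • ((y h - x h - (y 0 - x 0) - h • fderiv ℝ f (x 0) (y 0 - x 0))
        + (y μ - y h - (μ - h) • f (x 0))) := by
      have h8 : μ - h = - (ρ * (h * (k * a))) := by rw [hμ]; ring
      have h9 : y 0 - x 0 = ρ • u := by rw [hu, smul_inv_smul₀ hρ0.ne']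
      rw [h8, hu', h9, map_smul]
      simp only [hw, smul_add, smul_sub, neg_smul, smul_neg, smul_smul]
      field_simp
      module
    rw [this, norm_smul, norm_inv, Real.norm_of_nonneg hρ0.le]
    calc ρ⁻¹ * _ ≤ ρ⁻¹ * (η / 2 * ρ * h + η / 2 * ρ * h) := by
          gcongr; exact (norm_add_le _ _).trans (add_le_add e2 e3)
      _ = η * h := by field_simp; ring
  have e5 : ‖(x h, u') - (x 0, u) - h • (f (x 0), w)‖ ≤ η * h := by
    simpa [Prod.norm_def] using And.intro e1 e4
  have hwn : ‖(f (x 0), w)‖ ≤ R := by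
    have h8 : ‖w‖ ≤ A + k * B * M := by
      refine (norm_sub_le _ _).trans (add_le_add ?_ ?_)
      · have := (fderiv ℝ f (x 0)).le_opNorm u
        rw [hu1, mul_one] at this
        exact this.trans (hA _ hx0)
      · rw [norm_smul, Real.norm_eq_abs]
        gcongr
        exact hM _ hx0
    rw [Prod.norm_mk, max_le_iff]
    exact ⟨(hM _ hx0).trans (by rw [hR]; linarith [norm_nonneg w]), h8.trans (by linarith)⟩
  have e6 : ‖(x h, u') - (x 0, u)‖ ≤ (R + 1) * h := by
    calc ‖(x h, u') - (x 0, u)‖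
        = ‖((x h, u') - (x 0, u) - h • (f (x 0), w)) + h • (f (x 0), w)‖ := by
          rw [sub_add_cancel]
      _ ≤ η * h + h * R := by
          refine (norm_add_le _ _).trans (add_le_add e5 ?_)
          rw [norm_smul, Real.norm_of_nonneg h0.le]
          gcongr
      _ ≤ 1 * h + h * R := by gcongr
      _ = (R + 1) * h := by ring
  have e7 := hstrict (x 0, u) hz (x h, u') (x 0, u) (by rw [dist_eq_norm]; linarith)
    (by simpa using hr)
  have e8 : F (x h, u') ≤ F (x 0, u) + h * fderiv ℝ F (x 0, u) (f (x 0), w) + lam * m / 4 * h := by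
    have h8 : fderiv ℝ F (x 0, u) ((x h, u') - (x 0, u)) = h * fderiv ℝ F (x 0, u) (f (x 0), w)
        + fderiv ℝ F (x 0, u) ((x h, u') - (x 0, u) - h • (f (x 0), w)) := by
      rw [map_sub _ ((x h, u') - (x 0, u)), map_smul, smul_eq_mul]; ring
    have h9 : fderiv ℝ F (x 0, u) ((x h, u') - (x 0, u) - h • (f (x 0), w)) ≤ lam * m / 8 * h := by
      refine (le_abs_self _).trans (((fderiv ℝ F (x 0, u)).le_opNorm _).trans ?_)
      calc _ ≤ N * (η * h) := by gcongr; exact hN _ hz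
        _ = N * η * h := by ring
        _ ≤ _ := by gcongr
    have h10 : lam * m / (8 * (R + 1)) * ‖(x h, u') - (x 0, u)‖ ≤ lam * m / 8 * h := by
      calc _ ≤ lam * m / (8 * (R + 1)) * ((R + 1) * h) := by gcongr
        _ = lam * m / 8 * h := by field_simp
    have h11 := (le_abs_self _).trans e7
    have h12 : F (x h, u') - F (x 0, u) - fderiv ℝ F (x 0, u) ((x h, u') - (x 0, u))
      ≤ lam * m / 8 * h := h11.trans h10
    linarith
  have e9 : fderiv ℝ F (x 0, u) (f (x 0), w) ≤ -(lam / 2) * V (x 0) u := hgain _ hx0 _ huS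
  have e10 : m ≤ V (x 0) u := by simpa [hu1] using (hmV _ hx0 u).1
  have e11 : V (x h) u' ≤ (1 - lam * h / 4) * V (x 0) u := by
    have h8 := mul_le_mul_of_nonneg_left e9 h0.le
    have h9 := mul_le_mul_of_nonneg_left e10 (by positivity : 0 ≤ lam * h / 4)
    simp only [hF] at e8 h8
    linarith
  have e12 : V (x 0) (y 0 - x 0) = ρ * V (x 0) u := hV.eq_norm_mul (hKU hx0) hδ
  have e13 : V (x h) (y μ - x h) = ρ * V (x h) u' := by
    rw [← hV.homogeneous _ (hKU hxh) _ _ hρ0.le, hu', smul_inv_smul₀ hρ0.ne']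
  rw [e12, e13]
  calc ρ * V (x h) u' ≤ ρ * ((1 - lam * h / 4) * V (x 0) u) := by gcongr
    _ = _ := by ring

end Finsler

/-! ### Iteration of the contraction step and convergence of the time offsets. -/

section Synchronization

variable {n : ℕ} {U K : Set (EuclideanSpace ℝ (Fin n))}
  {f : EuclideanSpace ℝ (Fin n) → EuclideanSpace ℝ (Fin n)}
  {V : EuclideanSpace ℝ (Fin n) → EuclideanSpace ℝ (Fin n) → ℝ} {lam : ℝ}

/-- `x` and `y` are asymptotic to each other up to a shift of time. -/
def AsymptoticUpToShift {E : Type*} [NormedAddCommGroup E] (x y : ℝ → E) : Prop :=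
  ∃ σ : ℝ, Tendsto (fun t => x t - y (t + σ)) atTop (𝓝 0)

theorem AsymptoticUpToShift.symm {E : Type*} [NormedAddCommGroup E] {x y : ℝ → E}
    (h : AsymptoticUpToShift x y) : AsymptoticUpToShift y x := by
  obtain ⟨σ, h⟩ := h
  refine ⟨-σ, ?_⟩
  simpa [Function.comp_def] using (h.comp (tendsto_atTop_add_const_right _ (-σ) tendsto_id)).neg

theorem AsymptoticUpToShift.trans {E : Type*} [NormedAddCommGroup E] {x y z : ℝ → E}
    (h : AsymptoticUpToShift x y) (h' : AsymptoticUpToShift y z) : AsymptoticUpToShift x z := by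
  obtain ⟨σ, h⟩ := h
  obtain ⟨σ', h'⟩ := h'
  refine ⟨σ + σ', ?_⟩
  simpa [Function.comp_def, add_assoc] using
    h.add (h'.comp (tendsto_atTop_add_const_right _ σ tendsto_id))

/-- Closeness of two solutions along a sequence of equidistant times extends to all times. -/
theorem tendsto_sub_of_tendsto_sub_nat_mul {L : NNReal} (hL : LipschitzOnWith L f K)
    {x y : ℝ → EuclideanSpace ℝ (Fin n)} (hx : IsSolutionOn K f (Ici 0) x)
    (hy : IsSolutionOn K f (Ici 0) y) {h σ : ℝ} (h0 : 0 < h)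
    (hlim : Tendsto (fun j : ℕ => y (j * h + σ) - x (j * h)) atTop (𝓝 0)) :
    Tendsto (fun t => x t - y (t + σ)) atTop (𝓝 0) := by
  have hfloor : Tendsto (fun t : ℝ => ⌊t / h⌋₊) atTop atTop :=
    tendsto_nat_floor_atTop.comp (tendsto_id.atTop_div_const h0)
  have hcast : Tendsto (fun t : ℝ => (⌊t / h⌋₊ : ℝ) * h + σ) atTop atTop :=
    tendsto_atTop_add_const_right _ _
      ((tendsto_natCast_atTop_atTop.comp hfloor).atTop_mul_const h0)
  -- Between consecutive grid times Grönwall costs at most the factor `exp (L * h)`.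
  have hbound := ((hlim.comp hfloor).norm).mul_const (Real.exp (L * h))
  rw [norm_zero, zero_mul] at hbound
  refine squeeze_zero_norm' ?_ hbound
  filter_upwards [hcast.eventually_ge_atTop 0, eventually_ge_atTop 0] with t ht ht0
  set j := ⌊t / h⌋₊ with hj
  have hjt : j * h ≤ t := (le_div_iff₀ h0).1 (Nat.floor_le (by positivity))
  have htj : t ≤ (j + 1) * h := ((div_lt_iff₀ h0).1 (Nat.lt_floor_add_one (t / h))).le
  have := (hx.shift (a := j * h) (by positivity)).norm_sub_le_exp (hy.shift ht) hL
    (t := t - j * h) (by linarith)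
  rw [add_zero, add_zero, add_sub_cancel, show j * h + σ + (t - j * h) = t + σ by ring,
    norm_sub_rev] at this
  refine this.trans ?_
  simp only [Function.comp_apply, ← hj]
  gcongr
  linarith

/-- Solutions that start close to each other, at any place of `K`, are asymptotic to each other
up to a shift of time. -/
theorem TransverselyContracting.exists_asymptoticUpToShift_of_close
    (hcontr : TransverselyContracting f K V lam)
    (hV : IsFinslerFunction U V) (hU : IsOpen U) (hK : IsCompact K) (hKU : K ⊆ U)
    (hf : ContDiffOn ℝ 1 f U) (hlam : 0 < lam) {L : NNReal} (hL : LipschitzOnWith L f K) :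
    ∃ r > 0, ∀ x y, IsSolutionOn K f (Ici 0) x → IsSolutionOn K f (Ici 0) y →
      ‖y 0 - x 0‖ < r → AsymptoticUpToShift x y := by
  obtain ⟨h, h0, ρ₀, hρ₀, q, hq0, hq1, c, hc, hstep⟩ :=
    hcontr.exists_step hV hU hK hKU hf hlam hL
  obtain ⟨m, hm, C, hC, hmV⟩ := hV.exists_norm_bounds hK hKU
  obtain ⟨M, hM0, hM⟩ := hK.exists_nonneg_forall_norm_le (hf.continuousOn.mono hKU)
  -- This radius ensures `C * D / m ≤ ρ₀`, so every iterate stays within reach of the contraction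
  -- step.
  refine ⟨ρ₀ * m / (C + 1), by positivity, fun x y hx hy hr => ?_⟩
  have hstep' : ∀ (j : ℕ) (θ : ℝ), ∃ θ', 0 ≤ θ → ‖y θ - x (j * h)‖ ≤ ρ₀ →
      0 ≤ θ' ∧ |θ' - θ - h| ≤ c * ‖y θ - x (j * h)‖ ∧
      V (x ((j + 1 : ℕ) * h)) (y θ' - x ((j + 1 : ℕ) * h))
        ≤ q * V (x (j * h)) (y θ - x (j * h)) := by
    intro j θ
    by_cases H : 0 ≤ θ ∧ ‖y θ - x (j * h)‖ ≤ ρ₀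
    · obtain ⟨μ, hμ0, hμ1, hμ2⟩ := hstep _ _ (hx.shift (a := j * h) (by positivity))
        (hy.shift H.1) (by simpa using H.2)
      simp only [add_zero] at hμ1 hμ2
      refine ⟨θ + μ, fun _ _ => ⟨add_nonneg H.1 hμ0, by simpa using hμ1, ?_⟩⟩
      rwa [Nat.cast_succ, add_mul, one_mul]
    · exact ⟨0, fun h1 h2 => (H ⟨h1, h2⟩).elim⟩
  choose next hnext using hstep'
  -- `θ j` is the time of `y` that is matched with the time `j * h` of `x`.
  let θ : ℕ → ℝ := fun j => Nat.rec 0 (fun j t => next j t) j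
  have hxK : ∀ j : ℕ, x (j * h) ∈ K := fun j => (hx _ (mem_Ici.2 (by positivity))).1
  set D := ‖y 0 - x 0‖ with hD
  have hDρ : C * D ≤ m * ρ₀ := by
    have h1 : D * (C + 1) < ρ₀ * m := (lt_div_iff₀ (by positivity)).1 hr
    nlinarith [norm_nonneg (y 0 - x 0)]
  have hsmall : ∀ j : ℕ, V (x (j * h)) (y (θ j) - x (j * h)) ≤ C * D * q ^ j →
      ‖y (θ j) - x (j * h)‖ ≤ C * D / m * q ^ j := fun j hj => by
    have := ((hmV _ (hxK j) (y (θ j) - x (j * h))).1).trans hj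
    rw [div_mul_eq_mul_div, le_div_iff₀ hm, mul_comm]
    exact this
  have hle : ∀ j : ℕ, C * D / m * q ^ j ≤ ρ₀ := fun j => by
    calc C * D / m * q ^ j ≤ C * D / m * 1 := by
          gcongr; exact pow_le_one₀ hq0 hq1.le
      _ ≤ ρ₀ := by rw [mul_one, div_le_iff₀ hm]; linarith
  have hind : ∀ j : ℕ, 0 ≤ θ j ∧ V (x (j * h)) (y (θ j) - x (j * h)) ≤ C * D * q ^ j := by
    intro j
    induction j with
    | zero =>
      refine ⟨le_rfl, ?_⟩
      simpa [θ] using (hmV _ (hx 0 self_mem_Ici).1 (y 0 - x 0)).2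
    | succ j ih =>
      obtain ⟨h1, -, h2⟩ := hnext j (θ j) ih.1 ((hsmall j ih.2).trans (hle j))
      refine ⟨h1, h2.trans ?_⟩
      calc q * V (x (j * h)) (y (θ j) - x (j * h)) ≤ q * (C * D * q ^ j) := by
            gcongr; exact ih.2
        _ = C * D * q ^ (j + 1) := by ring
  have hdist : ∀ j : ℕ, ‖y (θ j) - x (j * h)‖ ≤ C * D / m * q ^ j := fun j =>
    hsmall j (hind j).2
  have hcauchy : CauchySeq fun j : ℕ => θ j - j * h :=
    cauchySeq_of_le_geometric q (c * (C * D / m)) hq1 fun j => by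
      have h1 := (hnext j (θ j) (hind j).1 ((hdist j).trans (hle j))).2.1
      rw [dist_comm, Real.dist_eq, mul_assoc]
      have h2 : θ (j + 1) - ((j + 1 : ℕ) : ℝ) * h - (θ j - j * h) = next j (θ j) - θ j - h := by
        push_cast; simp only [θ]; ring
      rw [h2]
      refine h1.trans ?_
      gcongr
      exact hdist j
  obtain ⟨σ, hσ⟩ := cauchySeq_tendsto_of_complete hcauchy
  refine ⟨σ, tendsto_sub_of_tendsto_sub_nat_mul hL hx hy h0 ?_⟩
  have hjh : Tendsto (fun j : ℕ => (j : ℝ) * h + σ) atTop atTop :=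
    tendsto_atTop_add_const_right _ _ (tendsto_natCast_atTop_atTop.atTop_mul_const h0)
  -- Replacing `θ j` by `j * h + σ` costs at most the speed bound `M` times the remaining offset
  -- error.
  have hlim : Tendsto (fun j : ℕ => M * |σ - (θ j - j * h)| + C * D / m * q ^ j) atTop (𝓝 0) := by
    have h1 := ((tendsto_const_nhds (x := σ)).sub hσ).abs.const_mul M
    have h2 := (tendsto_pow_atTop_nhds_zero_of_lt_one hq0 hq1).const_mul (C * D / m)
    simpa using h1.add h2
  refine squeeze_zero_norm' ?_ hlim
  filter_upwards [hjh.eventually_ge_atTop 0] with j hj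
  have h1 := hy.norm_sub_le hM (hind j).1 hj
  rw [show j * h + σ - θ j = σ - (θ j - j * h) by ring] at h1
  exact (norm_sub_le_norm_sub_add_norm_sub _ (y (θ j)) _).trans (add_le_add h1 (hdist j))

end Synchronization

/-! ### Global solutions from every point of `K`. -/

section Existence

/-- A smooth vector field coincides near a compact set with one that is smooth on the whole space
and has compact support. -/
theorem exists_contDiff_hasCompactSupport_eq_near {E : Type*} [NormedAddCommGroup E]
    [NormedSpace ℝ E] [FiniteDimensional ℝ E] {U K : Set E} {f : E → E} (hU : IsOpen U)
    (hKU : K ⊆ U) (hf : ContDiffOn ℝ 1 f U) (hK : IsCompact K) :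
    ∃ g : E → E, ContDiff ℝ 1 g ∧ HasCompactSupport g ∧
      ∃ W, IsOpen W ∧ K ⊆ W ∧ W ⊆ U ∧ EqOn g f W := by
  obtain ⟨T, hT, hKT, hTU⟩ := exists_compact_between hK hU hKU
  obtain ⟨χ, hχ1, hχ0, -⟩ := exists_contMDiffMap_one_nhds_of_subset_interior (n := 1)
    (modelWithCornersSelf ℝ E) hK.isClosed hKT
  have hχ : ContDiff ℝ 1 χ := χ.contMDiff.contDiff
  have hsupp : tsupport (fun x => χ x • f x) ⊆ T := by
    refine closure_minimal (fun x hx => ?_) hT.isClosed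
    by_contra h
    exact hx (by simp [hχ0 x h])
  refine ⟨fun x => χ x • f x, ?_, hT.of_isClosed_subset (isClosed_tsupport _) hsupp, ?_⟩
  · refine contDiff_iff_contDiffAt.2 fun x => ?_
    by_cases hx : x ∈ T
    · exact hχ.contDiffAt.smul (hf.contDiffAt (hU.mem_nhds (hTU hx)))
    · have : (fun x => χ x • f x) =ᶠ[𝓝 x] fun _ => 0 := by
        filter_upwards [hT.isClosed.isOpen_compl.mem_nhds hx] with y hy
        simp [hχ0 y hy]
      exact contDiffAt_const.congr_of_eventuallyEq this
  · obtain ⟨W, hW, hKW, hWχ⟩ := mem_nhdsSet_iff_exists.1 hχ1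
    refine ⟨W ∩ U, hW.inter hU, subset_inter hKW hKU, inter_subset_right, fun x hx => ?_⟩
    have : χ x = 1 := hWχ hx.1
    simp [this]

/-- Integral curves of a compactly supported `C^1` vector field exist for all times. -/
theorem exists_hasDerivAt_of_contDiff_of_hasCompactSupport {E : Type*} [NormedAddCommGroup E]
    [NormedSpace ℝ E] [CompleteSpace E] {g : E → E} (hg : ContDiff ℝ 1 g)
    (hsupp : HasCompactSupport g) (p : E) :
    ∃ γ : ℝ → E, γ 0 = p ∧ ∀ t, HasDerivAt γ (g (γ t)) t := by
  obtain ⟨L, hL⟩ := ContDiff.lipschitzWith_of_hasCompactSupport hsupp hg one_ne_zero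
  obtain ⟨C, hC⟩ := hsupp.exists_bound_of_continuous hg.continuous
  have hC0 : 0 ≤ C := (norm_nonneg _).trans (hC 0)
  have hone : ∀ v : E, (1 : ℝ →L[ℝ] ℝ).smulRight v = ContinuousLinearMap.toSpanSingleton ℝ v :=
    fun v => by ext; simp
  -- As `g` is bounded by `C` and globally Lipschitz, Picard–Lindelöf on balls of radius `C` gives
  -- the existence time 1 at every point, and a uniform existence time yields a global curve.
  obtain ⟨γ, h0, hγ⟩ := exists_isMIntegralCurve_of_isMIntegralCurveOn
    (I := modelWithCornersSelf ℝ E) (v := g) (contMDiff_vectorSpace_iff_contDiff.2 hg)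
    one_pos (fun x => by
      have hPL : IsPicardLindelof (fun _ => g) (tmin := -1) (tmax := 1) ⟨0, by simp⟩ x
          ⟨C, hC0⟩ 0 ⟨C, hC0⟩ L :=
        .of_time_independent (fun y _ => hC y) hL.lipschitzOnWith (by simp)
      obtain ⟨α, hα0, hα⟩ := hPL.exists_eq_forall_mem_Icc_hasDerivWithinAt₀
      refine ⟨α, hα0, ?_⟩
      intro t ht
      have := ((hα t (Ioo_subset_Icc_self ht)).mono Ioo_subset_Icc_self).hasFDerivWithinAt
      rw [← hone] at this
      exact hasMFDerivWithinAt_iff_hasFDerivWithinAt.2 this) p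
  refine ⟨γ, h0, fun t => ?_⟩
  have : HasFDerivAt γ ((1 : ℝ →L[ℝ] ℝ).smulRight (g (γ t))) t :=
    hasMFDerivAt_iff_hasFDerivAt.1 (hγ t)
  rw [hone] at this
  exact hasDerivAt_iff_hasFDerivAt.2 this

variable {n : ℕ} {U K : Set (EuclideanSpace ℝ (Fin n))}
  {f : EuclideanSpace ℝ (Fin n) → EuclideanSpace ℝ (Fin n)}

theorem StrictlyForwardInvariant.isSolutionOn (hinv : StrictlyForwardInvariant U f K)
    {x : ℝ → EuclideanSpace ℝ (Fin n)} (hx : IsSolutionOn U f (Ici 0) x) (h0 : x 0 ∈ K) :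
    IsSolutionOn K f (Ici 0) x := by
  intro t ht
  refine ⟨?_, (hx t ht).2⟩
  rcases (mem_Ici.1 ht).eq_or_lt with rfl | ht'
  · exact h0
  · exact interior_subset
      (hinv t x ht' (hx.mono Icc_subset_Ici_self) h0 t ⟨ht', le_rfl⟩)

/-- Continuous induction: whenever the integral curve of `g` is in `K`, it remains in `W` for a
short time, where it solves the equation for `f`, so invariance keeps it in `K`. Chaining along `K`
needs a solution from each of its points. -/
theorem StrictlyForwardInvariant.exists_isSolutionOn (hinv : StrictlyForwardInvariant U f K)
    {g : EuclideanSpace ℝ (Fin n) → EuclideanSpace ℝ (Fin n)} (hg : ContDiff ℝ 1 g)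
    (hsupp : HasCompactSupport g) (hK : IsCompact K) {W : Set (EuclideanSpace ℝ (Fin n))}
    (hW : IsOpen W) (hKW : K ⊆ W) (hWU : W ⊆ U) (hgf : EqOn g f W)
    {p : EuclideanSpace ℝ (Fin n)} (hp : p ∈ K) :
    ∃ x, IsSolutionOn K f (Ici 0) x ∧ x 0 = p := by
  obtain ⟨x, hx0, hx⟩ := exists_hasDerivAt_of_contDiff_of_hasCompactSupport hg hsupp p
  have hcont : Continuous x := continuous_iff_continuousAt.2 fun t => (hx t).continuousAt
  have hmem : ∀ T : ℝ, 0 ≤ T → Icc 0 T ⊆ x ⁻¹' K := fun T hT => by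
    refine IsClosed.Icc_subset_of_forall_exists_gt
      ((hK.isClosed.preimage hcont).inter isClosed_Icc) (by rw [mem_preimage, hx0]; exact hp)
      fun t ht s hs => ?_
    have hnhds : x ⁻¹' W ∈ 𝓝 t := (hW.preimage hcont).mem_nhds (hKW ht.1)
    obtain ⟨ε, hε, hball⟩ := Metric.mem_nhds_iff.1 hnhds
    have hts : 0 < s - t := sub_pos.2 hs
    set b := min (s - t) (ε / 2) with hb
    have hb0 : 0 < b := lt_min hts (half_pos hε)
    refine ⟨t + b, ?_, by linarith, by linarith [min_le_left (s - t) (ε / 2)]⟩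
    have hsol : IsSolutionOn U f (Icc 0 b) (fun r => x (t + r)) := fun r hr => by
      have hr' : x (t + r) ∈ W := hball (by
        rw [Metric.mem_ball, Real.dist_eq, add_sub_cancel_left, abs_of_nonneg hr.1]
        linarith [hr.2, min_le_right (s - t) (ε / 2)])
      refine ⟨hWU hr', ?_⟩
      rw [← hgf hr']
      exact ((hx (t + r)).comp_const_add t r).hasDerivWithinAt
    show x (t + b) ∈ K
    exact interior_subset (hinv b _ hb0 hsol (by simpa using ht.1) b ⟨hb0, le_rfl⟩)
  refine ⟨x, fun t ht => ?_, hx0⟩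
  have hxt : x t ∈ K := hmem t ht ⟨ht, le_rfl⟩
  exact ⟨hxt, by rw [← hgf (hKW hxt)]; exact (hx t).hasDerivWithinAt⟩

end Existence

/-! ### Connectedness, realisation of shifts, and the main theorem. -/

theorem SmoothlyPathConnected.isPreconnected {n : ℕ} {K : Set (EuclideanSpace ℝ (Fin n))}
    (h : SmoothlyPathConnected K) : IsPreconnected K := by
  refine isPreconnected_of_forall_pair fun p hp q hq => ?_
  obtain ⟨γ, hγ, h0, h1, hγK⟩ := h p hp q hq
  exact ⟨γ '' Icc 0 1, image_subset_iff.2 hγK, ⟨0, by simp, h0⟩, ⟨1, by simp, h1⟩,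
    isPreconnected_Icc.image _ hγ.continuousOn⟩

/-- Every shift of time is asymptotic to a time reparametrization of the half line. -/
theorem exists_isTimeReparametrization_sub_shift_tendsto_zero (σ : ℝ) :
    ∃ τ, IsTimeReparametrization τ ∧ Tendsto (fun t => τ t - (t + σ)) atTop (𝓝 0) := by
  rcases le_or_gt 0 σ with hσ | hσ
  · refine ⟨fun t => t + σ, ⟨(contDiff_id.add contDiff_const).contDiffOn, fun t ht =>
      add_nonneg ht hσ, (strictMono_id.add_const σ).strictMonoOn _,
      tendsto_atTop_add_const_right _ _ tendsto_id⟩, by simp⟩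
  · have hpos : ∀ t : ℝ, 0 < t ^ 2 + σ ^ 2 := fun t => by
      nlinarith [sq_nonneg t, mul_pos_of_neg_of_neg hσ hσ]
    have hle : ∀ t : ℝ, t ≤ √(t ^ 2 + σ ^ 2) := fun t =>
      Real.le_sqrt_of_sq_le (by linarith [sq_nonneg σ])
    -- For `σ < 0` the shift leaves the half line. This hyperbola branch is asymptotic to it, starts
    -- at `0`, and is smooth because the radicand is positive.
    refine ⟨fun t => √(t ^ 2 + σ ^ 2) + σ, ⟨?_, fun t _ => ?_, fun s hs t _ hst => ?_, ?_⟩, ?_⟩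
    · exact ((((contDiff_id.pow 2).add contDiff_const).sqrt fun t => (hpos t).ne').add
        contDiff_const).contDiffOn
    · have : -σ ≤ √(t ^ 2 + σ ^ 2) := Real.le_sqrt_of_sq_le (by nlinarith [sq_nonneg t])
      exact mem_Ici.2 (by linarith)
    · have : s ^ 2 < t ^ 2 := pow_lt_pow_left₀ hst hs two_ne_zero
      have := Real.sqrt_lt_sqrt (hpos s).le (by linarith : s ^ 2 + σ ^ 2 < t ^ 2 + σ ^ 2)
      simpa using this
    · exact tendsto_atTop_add_const_right _ _ (tendsto_atTop_mono hle tendsto_id)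
    · have h1 : Tendsto (fun t : ℝ => σ ^ 2 / t) atTop (𝓝 0) :=
        tendsto_const_nhds.div_atTop tendsto_id
      refine squeeze_zero' (Eventually.of_forall fun t => ?_) ?_ h1
      · linarith [hle t]
      · filter_upwards [eventually_gt_atTop 0] with t ht
        have h2 : √(t ^ 2 + σ ^ 2) ≤ t + σ ^ 2 / t := by
          refine Real.sqrt_le_iff.2 ⟨by positivity, ?_⟩
          have h3 : (t + σ ^ 2 / t) ^ 2 = t ^ 2 + 2 * σ ^ 2 + (σ ^ 2 / t) ^ 2 := by
            field_simp
            ring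
          rw [h3]
          nlinarith [sq_nonneg σ, sq_nonneg (σ ^ 2 / t)]
        linarith

theorem theorem1 {n : ℕ}
    (U K : Set (EuclideanSpace ℝ (Fin n)))
    (f : EuclideanSpace ℝ (Fin n) → EuclideanSpace ℝ (Fin n))
    (V : EuclideanSpace ℝ (Fin n) → EuclideanSpace ℝ (Fin n) → ℝ) (lam : ℝ)
    (hU : IsOpen U) (hKU : K ⊆ U) (hf : ContDiffOn ℝ ∞ f U)
    (hK : IsCompact K) (hpath : SmoothlyPathConnected K)
    (hinv : StrictlyForwardInvariant U f K)
    (hV : IsFinslerFunction U V) (hlam : 0 < lam)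
    (hcontr : TransverselyContracting f K V lam)
    (x₁ x₂ : ℝ → EuclideanSpace ℝ (Fin n))
    (hx₁ : IsSolutionOn U f (Ici 0) x₁) (hx₂ : IsSolutionOn U f (Ici 0) x₂)
    (h₁ : x₁ 0 ∈ K) (h₂ : x₂ 0 ∈ K) :
    ∃ τ : ℝ → ℝ, IsTimeReparametrization τ ∧
      Tendsto (fun t => x₁ t - x₂ (τ t)) atTop (𝓝 0) := by
  have hf1 : ContDiffOn ℝ 1 f U := hf.of_le (by exact_mod_cast le_top)
  obtain ⟨g, hg, hgsupp, W, hW, hKW, hWU, hgf⟩ :=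
    exists_contDiff_hasCompactSupport_eq_near hU hKU hf1 hK
  obtain ⟨L, hL⟩ := ContDiff.lipschitzWith_of_hasCompactSupport hgsupp hg one_ne_zero
  -- `K` need not be convex, so the Lipschitz constant is taken from the cut-off field on the whole
  -- space.
  have hLf : LipschitzOnWith L f K := fun a ha b hb => by
    rw [← hgf (hKW ha), ← hgf (hKW hb)]; exact hL a b
  have hy₁ := hinv.isSolutionOn hx₁ h₁
  have hy₂ := hinv.isSolutionOn hx₂ h₂
  obtain ⟨r, hr, hclose⟩ :=
    hcontr.exists_asymptoticUpToShift_of_close hV hU hK hKU hf1 hlam hLf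
  have hex := fun p : K => hinv.exists_isSolutionOn hg hgsupp hK hW hKW hWU hgf p.2
  choose φ hφ hφ0 using hex
  have : PreconnectedSpace K := isPreconnected_iff_preconnectedSpace.1 hpath.isPreconnected
  -- No continuity of `φ` in the initial point is needed: closeness of the initial points alone
  -- gives the relation locally.
  have hrel : AsymptoticUpToShift (φ ⟨x₁ 0, h₁⟩) (φ ⟨x₂ 0, h₂⟩) := by
    refine PreconnectedSpace.induction₂' (fun p q : K => AsymptoticUpToShift (φ p) (φ q))
      (fun p => ?_) ⟨fun _ _ _ => AsymptoticUpToShift.trans⟩ _ _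
    filter_upwards [Metric.ball_mem_nhds p hr] with q hq
    have : AsymptoticUpToShift (φ p) (φ q) := hclose _ _ (hφ p) (hφ q) (by
      rw [hφ0, hφ0, ← dist_eq_norm]; exact hq)
    exact ⟨this, this.symm⟩
  -- A given solution and the chosen one have the same initial point, so `hclose` at distance `0`
  -- links them.
  obtain ⟨σ, hσ⟩ := ((hclose _ _ hy₁ (hφ ⟨x₁ 0, h₁⟩) (by simpa [hφ0] using hr)).trans hrel).trans
    (hclose _ _ (hφ ⟨x₂ 0, h₂⟩) hy₂ (by simpa [hφ0] using hr))
  obtain ⟨τ, hτ, hτσ⟩ := exists_isTimeReparametrization_sub_shift_tendsto_zero σ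
  refine ⟨τ, hτ, ?_⟩
  obtain ⟨M, -, hM⟩ := hK.exists_nonneg_forall_norm_le (hf1.continuousOn.mono hKU)
  have h3 : Tendsto (fun t => x₂ (t + σ) - x₂ (τ t)) atTop (𝓝 0) := by
    have h4 := hτσ.abs.const_mul M
    rw [abs_zero, mul_zero] at h4
    refine squeeze_zero_norm' ?_ h4
    filter_upwards [eventually_ge_atTop 0, eventually_ge_atTop (-σ)] with t ht htσ
    rw [norm_sub_rev]
    exact hy₂.norm_sub_le hM (by linarith) (hτ.mapsTo ht)
  simpa using hσ.add h3
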